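/- Let $d\ge 0$ and let $\Sigma_X,\Delta,\Omega$ be symmetric positive definite real $d\times d$ matrices, $\mu_X,\alpha,\beta\in\mathbb R^d$. Let $X\sim\mathcal N(\mu_X,\Sigma_X)$, $\varepsilon_Y\sim\mathcal N(\alpha,\Delta)$, $\varepsilon_Z\sim\mathcal N(\beta,\Omega)$ be (mutually) independent random vectors in $\mathbb R^d$, and let $Y=X+\varepsilon_Y$, $Z=X+\varepsilon_Z$. Put $$V=(\Delta^{-1}+\Omega^{-1}+\Sigma_X^{-1})^{-1},\qquad \overline X(y,z)=V\left[\Delta^{-1}(y-\alpha)+\Omega^{-1}(z-\beta)+\Sigma_X^{-1}\mu_X\right].$$ Then, for almost every $(y,z)$ with respect to the law of $(Y,Z)$, the conditional distribution of $X$ given $(Y,Z)=(y,z)$ is $\mathcal N(\overline X(y,z),V)$. Moreover, let $f$ be the density of $\mathcal N(\mu,\Sigma)$, with $\mu\in\mathbb R^d$ and $\Sigma$ a symmetric positive definite $d\times d$ matrix, and let $s_0(f,x)=-\log f(x)$ be its logarithmic score. Then $s_0(f,X)$ is integrable, and the corrected log score $s_\vee(f,(y,z))=\mathbb E\left(s_0(f,X)\mid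 Y=y,\,Z=z\right)$ satisfies, for almost every $(y,z)$ with respect to the law of $(Y,Z)$, $$s_\vee(f,(y,z))=\tfrac12\operatorname{tr}\left(\Sigma^{-1}\left(V+(\overline X(y,z)-\mu)(\overline X(y,z)-\mu)^{T}\right)\right)+\tfrac d2\log 2\pi+\tfrac12\log|\Sigma|,$$ where $|\Sigma|$ is the determinant of $\Sigma$. Equivalently, $\mathbb E(s_0(f,X)\mid Y,Z)$ is almost surely equal to the right-hand side with $(y,z)$ replaced by $(Y,Z)$. -/

import Mathlib

open MeasureTheory ProbabilityTheory
open scoped Matrix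

noncomputable section

/-- The density of the (nondegenerate) normal distribution `N(μ, S)` on `ℝ^d`. -/
def gaussianDensity {d : ℕ} (μ : EuclideanSpace ℝ (Fin d)) (S : Matrix (Fin d) (Fin d) ℝ)
    (x : EuclideanSpace ℝ (Fin d)) : ℝ :=
  (Real.sqrt ((2 * Real.pi) ^ d * S.det))⁻¹ *
    Real.exp (-(1 / 2) * ((x - μ).ofLp ⬝ᵥ (S⁻¹ *ᵥ (x - μ).ofLp)))

/-- The logarithmic score `s₀(f, x) = -log f(x)` of a forecast density `f`. -/
def logScore {E : Type*} (f : E → ℝ) (x : E) : ℝ := -Real.log (f x)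

/-- The corrected version of a score `s₀`: the conditional expectation
`w ↦ 𝔼(s₀(X) | W = w)`, computed with the regular conditional distribution of `X` given `W`. -/
def correctedScore {Ω E F : Type*} [MeasurableSpace Ω] [MeasurableSpace E] [StandardBorelSpace E]
    [Nonempty E] [MeasurableSpace F] (s₀ : E → ℝ) (X : Ω → E) (W : Ω → F)
    (P : Measure Ω) [IsFiniteMeasure P] (w : F) : ℝ :=
  ∫ x, s₀ x ∂(condDistrib X W P w)

/-- The matrix `(Δ⁻¹ + Ω⁻¹ + Σ_X⁻¹)⁻¹`. -/
def posteriorCov {d : ℕ} (SX D Om : Matrix (Fin d) (Fin d) ℝ) : Matrix (Fin d) (Fin d) ℝ :=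
  (D⁻¹ + Om⁻¹ + SX⁻¹)⁻¹

/-- The weighted mean
`(Δ⁻¹ + Ω⁻¹ + Σ_X⁻¹)⁻¹ (Δ⁻¹ (y - α) + Ω⁻¹ (z - β) + Σ_X⁻¹ μ_X)`. -/
def posteriorMean {d : ℕ} (μX α β : EuclideanSpace ℝ (Fin d))
    (SX D Om : Matrix (Fin d) (Fin d) ℝ) (y z : EuclideanSpace ℝ (Fin d)) :
    EuclideanSpace ℝ (Fin d) :=
  WithLp.toLp 2 (posteriorCov SX D Om *ᵥ
    (D⁻¹ *ᵥ (y - α).ofLp + Om⁻¹ *ᵥ (z - β).ofLp + SX⁻¹ *ᵥ μX.ofLp))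

/-- The closed form
`½ tr(S⁻¹ (V + (m - μ)(m - μ)ᵀ)) + (d/2) log 2π + ½ log |S|`. -/
def gaussianScoreFormula {d : ℕ} (μ : EuclideanSpace ℝ (Fin d)) (S V : Matrix (Fin d) (Fin d) ℝ)
    (m : EuclideanSpace ℝ (Fin d)) : ℝ :=
  1 / 2 * (S⁻¹ * (V + Matrix.vecMulVec (m - μ).ofLp (m - μ).ofLp)).trace
    + (d : ℝ) / 2 * Real.log (2 * Real.pi) + 1 / 2 * Real.log S.det

end

/-!
Write `V` for the posterior covariance, `m(y, z)` for the posterior mean and `R = X - m(Y, Z)` for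
the residual. With `q = V r`, the number `⟪R, r⟫ + ⟪Y, y⟫ + ⟪Z, z⟫` is, up to a constant, a linear
form in the independent Gaussian vectors `X`, `εY`, `εZ`, with coefficients `Σ_X⁻¹ q + y + z`,
`y - Δ⁻¹ q` and `z - Ω⁻¹ q`. In its variance the cross terms between `q` and `(y, z)` cancel, and
`q ⬝ (Δ⁻¹ + Ω⁻¹ + Σ_X⁻¹) q = r ⬝ V r` is what remains of `q` (`quadraticForm_posterior`). Hence the
joint characteristic function of `((Y, Z), R)` factors, that is, `R` is independent of `(Y, Z)` with
law `N(0, V)` (`map_observations_residual_eq_prod`). Since `X = m(Y, Z) + R`, the conditional law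
of `X` is `N(0, V)` translated by `m(y, z)` (`condDistrib_ae_eq_map_const_add`).

The log score of `N(μ, S)` is a quadratic polynomial, hence integrable under every Gaussian law, and
its integral under `N(m, V)` follows from the first two moments
(`integral_logScore_gaussianDensity`). The conditional expectation is the integral against the
conditional law.
-/

open scoped RealInnerProductSpace

/-! ### Disintegration through an independent residual -/

lemma multivariateGaussian_zero_map_const_add {ι : Type*} [Fintype ι] [DecidableEq ι]
    (c : EuclideanSpace ℝ ι) (V : Matrix ι ι ℝ) :
    (multivariateGaussian 0 V).map (fun r => c + r) = multivariateGaussian c V := by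
  rw [multivariateGaussian, multivariateGaussian, Measure.map_map (by fun_prop) (by fun_prop)]
  congr 1
  ext x
  simp

/-- If the residual `X - m(W)` is independent of `W` with law `ν`, then the conditional law of `X`
given `W = w` is `ν` translated by `m w`. -/
lemma condDistrib_ae_eq_map_const_add {Ω E F : Type*} [MeasurableSpace Ω] [MeasurableSpace F]
    [NormedAddCommGroup E] [MeasurableSpace E] [BorelSpace E] [SecondCountableTopology E]
    [StandardBorelSpace E] {P : Measure Ω} [IsFiniteMeasure P] {X : Ω → E} {W : Ω → F}
    {m : F → E} (ν : Measure E) [IsProbabilityMeasure ν]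
    (hX : Measurable X) (hW : Measurable W) (hm : Measurable m)
    (h : P.map (fun ω => (W ω, X ω - m (W ω))) = (P.map W).prod ν) :
    ∀ᵐ w ∂(P.map W), condDistrib X W P w = ν.map (fun r => m w + r) := by
  have hg : Measurable (fun p : F × E => m p.1 + p.2) := by fun_prop
  let κ : Kernel F E := (Kernel.id ×ₖ Kernel.const F ν).map (fun p : F × E => m p.1 + p.2)
  have hκ (w : F) : κ w = ν.map (fun r => m w + r) := by
    rw [Kernel.map_apply _ hg, Kernel.prod_apply, Kernel.id_apply, Kernel.const_apply,
      Measure.dirac_prod, Measure.map_map hg (by fun_prop)]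
    rfl
  have : IsFiniteKernel κ := by infer_instance
  have hjoint : P.map (fun ω => (W ω, X ω)) = P.map W ⊗ₘ κ := by
    have hG : Measurable (fun p : F × E => (p.1, m p.1 + p.2)) := by fun_prop
    have hmap : P.map (fun ω => (W ω, X ω)) =
        ((P.map W).prod ν).map (fun p : F × E => (p.1, m p.1 + p.2)) := by
      rw [← h, Measure.map_map hG (by fun_prop)]
      congr 1
      ext ω <;> simp
    ext s hs
    rw [hmap, Measure.map_apply hG hs, Measure.prod_apply (hG hs), Measure.compProd_apply hs]
    refine lintegral_congr fun w => ?_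
    rw [hκ, Measure.map_apply (by fun_prop) (measurable_prodMk_left hs)]
    rfl
  filter_upwards [condDistrib_ae_eq_of_measure_eq_compProd_of_measurable hW hX hjoint] with w hw
  rw [hw, hκ]

/-! ### Characteristic functions of independent triples -/

lemma integral_cexp_inner_of_iIndepFun {Ω E : Type*} [MeasurableSpace Ω] {P : Measure Ω}
    [NormedAddCommGroup E] [InnerProductSpace ℝ E] [MeasurableSpace E] [BorelSpace E]
    [SecondCountableTopology E] {X₁ X₂ X₃ : Ω → E}
    (h₁ : Measurable X₁) (h₂ : Measurable X₂) (h₃ : Measurable X₃)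
    (h : iIndepFun ![X₁, X₂, X₃] P) (a b c : E) :
    ∫ ω, Complex.exp ((⟪X₁ ω, a⟫ + ⟪X₂ ω, b⟫ + ⟪X₃ ω, c⟫ : ℝ) * Complex.I) ∂P =
      charFun (P.map X₁) a * charFun (P.map X₂) b * charFun (P.map X₃) c := by
  have hmeas : ∀ i, Measurable ((![X₁, X₂, X₃] : Fin 3 → Ω → E) i) := by
    intro i
    fin_cases i <;> assumption
  have h₁₂ : IndepFun X₁ X₂ P := by
    simpa using! h.indepFun (i := 0) (j := 1) (by decide)
  have h₁₂₃ : IndepFun (fun ω => (X₁ ω, X₂ ω)) X₃ P := by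
    simpa using! h.indepFun_prodMk hmeas 0 1 2 (by decide) (by decide)
  have e (t : E) : Measurable fun x : E => Complex.exp ((⟪x, t⟫ : ℝ) * Complex.I) := by fun_prop
  rw [charFun_apply, charFun_apply, charFun_apply,
    integral_map h₁.aemeasurable (e a).aestronglyMeasurable,
    integral_map h₂.aemeasurable (e b).aestronglyMeasurable,
    integral_map h₃.aemeasurable (e c).aestronglyMeasurable,
    ← h₁₂.integral_fun_comp_mul_comp h₁.aemeasurable h₂.aemeasurable
      (e a).aestronglyMeasurable (e b).aestronglyMeasurable]
  have key := h₁₂₃.integral_fun_comp_mul_comp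
    (f := fun p : E × E => Complex.exp ((⟪p.1, a⟫ : ℝ) * Complex.I) *
      Complex.exp ((⟪p.2, b⟫ : ℝ) * Complex.I))
    (h₁.prodMk h₂).aemeasurable h₃.aemeasurable
    (((e a).comp measurable_fst).mul ((e b).comp measurable_snd)).aestronglyMeasurable
    (e c).aestronglyMeasurable
  rw [← key]
  refine integral_congr_ae (.of_forall fun ω => ?_)
  simp only [← Complex.exp_add]
  congr 1
  push_cast
  ring

/-- A pair `(W₁, W₂)` and a variable `R` whose joint characteristic function factors are
independent, and the second factor determines the law of `R`. -/
lemma map_prodMk_eq_prod_of_integral_cexp_inner {Ω E : Type*} [MeasurableSpace Ω] {P : Measure Ω}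
    [IsFiniteMeasure P] [NormedAddCommGroup E] [InnerProductSpace ℝ E] [CompleteSpace E]
    [MeasurableSpace E] [BorelSpace E] [SecondCountableTopology E] {W₁ W₂ R : Ω → E}
    (h₁ : Measurable W₁) (h₂ : Measurable W₂) (hR : Measurable R) (ν : Measure E)
    [IsFiniteMeasure ν]
    (h : ∀ y z r : E,
      ∫ ω, Complex.exp ((⟪W₁ ω, y⟫ + ⟪W₂ ω, z⟫ + ⟪R ω, r⟫ : ℝ) * Complex.I) ∂P =
        (∫ ω, Complex.exp ((⟪W₁ ω, y⟫ + ⟪W₂ ω, z⟫ : ℝ) * Complex.I) ∂P) * charFun ν r) :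
    P.map (fun ω => ((W₁ ω, W₂ ω), R ω)) = (P.map fun ω => (W₁ ω, W₂ ω)).prod ν := by
  rw [← charFunDual_eq_prod_iff]
  intro L
  have hriesz (T : StrongDual ℝ E) : ∃ t : E, ∀ x, T x = ⟪x, t⟫ :=
    ⟨(InnerProductSpace.toDual ℝ E).symm T, fun x => by
      rw [real_inner_comm, InnerProductSpace.toDual_symm_apply]⟩
  obtain ⟨y, hy⟩ := hriesz ((L.comp (.inl ℝ (E × E) E)).comp (.inl ℝ E E))
  obtain ⟨z, hz⟩ := hriesz ((L.comp (.inl ℝ (E × E) E)).comp (.inr ℝ E E))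
  obtain ⟨r, hr⟩ := hriesz (L.comp (.inr ℝ (E × E) E))
  have hL₁ (p : E × E) : L.comp (.inl ℝ (E × E) E) p = ⟪p.1, y⟫ + ⟪p.2, z⟫ := by
    rw [← hy, ← hz, ContinuousLinearMap.comp_apply _ (.inl ℝ E E),
      ContinuousLinearMap.comp_apply _ (.inr ℝ E E), ← map_add]
    simp
  have hL (p : (E × E) × E) : L p = ⟪p.1.1, y⟫ + ⟪p.1.2, z⟫ + ⟪p.2, r⟫ := by
    rw [← hL₁, ← hr, ContinuousLinearMap.comp_apply, ContinuousLinearMap.comp_apply, ← map_add]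
    simp
  rw [charFunDual_apply, charFunDual_apply, charFunDual_apply,
    integral_map ((h₁.prodMk h₂).prodMk hR).aemeasurable
      (Continuous.aestronglyMeasurable (by fun_prop)),
    integral_map (h₁.prodMk h₂).aemeasurable (Continuous.aestronglyMeasurable (by fun_prop))]
  simp_rw [hL, hL₁, hr]
  exact h y z r

/-! ### Linear algebra of the posterior -/

lemma Matrix.PosDef.dotProduct_mulVec_comm {ι : Type*} [Fintype ι] {A : Matrix ι ι ℝ}
    (hA : A.PosDef) (u v : ι → ℝ) : u ⬝ᵥ (A *ᵥ v) = v ⬝ᵥ (A *ᵥ u) := by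
  have hT : Aᵀ = A := by simpa using! hA.isHermitian.eq
  rw [Matrix.dotProduct_mulVec, ← Matrix.mulVec_transpose, hT, dotProduct_comm]

lemma Matrix.PosDef.mulVec_inv_mulVec {ι : Type*} [Fintype ι] [DecidableEq ι] {A : Matrix ι ι ℝ}
    (hA : A.PosDef) (v : ι → ℝ) : A *ᵥ (A⁻¹ *ᵥ v) = v := by
  rw [Matrix.mulVec_mulVec, Matrix.mul_nonsing_inv _ hA.det_pos.ne'.isUnit, Matrix.one_mulVec]

lemma Matrix.PosDef.dotProduct_mulVec_inv_mulVec_add {ι : Type*} [Fintype ι] [DecidableEq ι]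
    {A : Matrix ι ι ℝ} (hA : A.PosDef) (q s : ι → ℝ) :
    (A⁻¹ *ᵥ q + s) ⬝ᵥ (A *ᵥ (A⁻¹ *ᵥ q + s)) =
      q ⬝ᵥ (A⁻¹ *ᵥ q) + 2 * (q ⬝ᵥ s) + s ⬝ᵥ (A *ᵥ s) := by
  rw [Matrix.mulVec_add, hA.mulVec_inv_mulVec, add_dotProduct, dotProduct_add, dotProduct_add,
    hA.dotProduct_mulVec_comm (A⁻¹ *ᵥ q) s, hA.mulVec_inv_mulVec, dotProduct_comm _ q,
    dotProduct_comm s q]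
  ring

section Posterior

variable {d : ℕ} {SX D Om : Matrix (Fin d) (Fin d) ℝ}

lemma posteriorCov_posDef (hSX : SX.PosDef) (hD : D.PosDef) (hOm : Om.PosDef) :
    (posteriorCov SX D Om).PosDef :=
  ((hD.inv.add hOm.inv).add hSX.inv).inv

/-- `(D⁻¹ + Om⁻¹ + SX⁻¹) V r = r`, with the sum distributed over the vector. -/
lemma inv_mulVec_posteriorCov_mulVec (hSX : SX.PosDef) (hD : D.PosDef) (hOm : Om.PosDef)
    (r : Fin d → ℝ) :
    D⁻¹ *ᵥ (posteriorCov SX D Om *ᵥ r) + Om⁻¹ *ᵥ (posteriorCov SX D Om *ᵥ r) +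
      SX⁻¹ *ᵥ (posteriorCov SX D Om *ᵥ r) = r := by
  rw [← Matrix.add_mulVec, ← Matrix.add_mulVec]
  exact ((hD.inv.add hOm.inv).add hSX.inv).mulVec_inv_mulVec r

lemma measurable_posteriorMean (μX α β : EuclideanSpace ℝ (Fin d)) :
    Measurable fun p : EuclideanSpace ℝ (Fin d) × EuclideanSpace ℝ (Fin d) =>
      posteriorMean μX α β SX D Om p.1 p.2 := by
  apply Continuous.measurable
  unfold posteriorMean
  fun_prop

/-- The residual as a linear function of the centred signal and the centred noises. -/
lemma dotProduct_sub_posteriorMean (hSX : SX.PosDef) (hD : D.PosDef) (hOm : Om.PosDef)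
    (μX α β x e f : EuclideanSpace ℝ (Fin d)) (r : Fin d → ℝ) :
    (x - posteriorMean μX α β SX D Om (x + e) (x + f)).ofLp ⬝ᵥ r =
      (x - μX).ofLp ⬝ᵥ (SX⁻¹ *ᵥ (posteriorCov SX D Om *ᵥ r))
        - (e - α).ofLp ⬝ᵥ (D⁻¹ *ᵥ (posteriorCov SX D Om *ᵥ r))
        - (f - β).ofLp ⬝ᵥ (Om⁻¹ *ᵥ (posteriorCov SX D Om *ᵥ r)) := by
  have hr := inv_mulVec_posteriorCov_mulVec hSX hD hOm r
  have hV := posteriorCov_posDef hSX hD hOm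
  set q := posteriorCov SX D Om *ᵥ r with hq
  have hxr : x.ofLp ⬝ᵥ r =
      x.ofLp ⬝ᵥ (D⁻¹ *ᵥ q) + x.ofLp ⬝ᵥ (Om⁻¹ *ᵥ q) + x.ofLp ⬝ᵥ (SX⁻¹ *ᵥ q) := by
    rw [← dotProduct_add, ← dotProduct_add, hr]
  simp only [posteriorMean, WithLp.ofLp_sub, WithLp.ofLp_add, sub_dotProduct, hxr]
  rw [dotProduct_comm _ r, hV.dotProduct_mulVec_comm, ← hq, add_dotProduct, add_dotProduct,
    dotProduct_comm _ q, dotProduct_comm _ q, dotProduct_comm _ q, hD.inv.dotProduct_mulVec_comm q,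
    hOm.inv.dotProduct_mulVec_comm q, hSX.inv.dotProduct_mulVec_comm q]
  simp only [sub_dotProduct, add_dotProduct]
  ring

/-- Completing the square. The cross terms cancel, which is the independence of the residual
`X - 𝔼(X | Y, Z)` and `(Y, Z)`. -/
lemma quadraticForm_posterior (hSX : SX.PosDef) (hD : D.PosDef) (hOm : Om.PosDef)
    (r y z : Fin d → ℝ) :
    (SX⁻¹ *ᵥ (posteriorCov SX D Om *ᵥ r) + (y + z)) ⬝ᵥ
        (SX *ᵥ (SX⁻¹ *ᵥ (posteriorCov SX D Om *ᵥ r) + (y + z))) +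
      (D⁻¹ *ᵥ (-(posteriorCov SX D Om *ᵥ r)) + y) ⬝ᵥ
        (D *ᵥ (D⁻¹ *ᵥ (-(posteriorCov SX D Om *ᵥ r)) + y)) +
      (Om⁻¹ *ᵥ (-(posteriorCov SX D Om *ᵥ r)) + z) ⬝ᵥ
        (Om *ᵥ (Om⁻¹ *ᵥ (-(posteriorCov SX D Om *ᵥ r)) + z)) =
      r ⬝ᵥ (posteriorCov SX D Om *ᵥ r) +
        ((y + z) ⬝ᵥ (SX *ᵥ (y + z)) + y ⬝ᵥ (D *ᵥ y) + z ⬝ᵥ (Om *ᵥ z)) := by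
  have hr := inv_mulVec_posteriorCov_mulVec hSX hD hOm r
  set q := posteriorCov SX D Om *ᵥ r
  have hrq : r ⬝ᵥ q = q ⬝ᵥ (D⁻¹ *ᵥ q) + q ⬝ᵥ (Om⁻¹ *ᵥ q) + q ⬝ᵥ (SX⁻¹ *ᵥ q) := by
    rw [← dotProduct_add, ← dotProduct_add, hr, dotProduct_comm]
  rw [hSX.dotProduct_mulVec_inv_mulVec_add, hD.dotProduct_mulVec_inv_mulVec_add,
    hOm.dotProduct_mulVec_inv_mulVec_add, hrq]
  simp only [Matrix.mulVec_neg, neg_dotProduct, dotProduct_neg, dotProduct_add]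
  ring

/-! ### The residual of the observation model -/

variable {Ω : Type*} [MeasurableSpace Ω] {P : Measure Ω}
  {μX α β : EuclideanSpace ℝ (Fin d)} {X εY εZ : Ω → EuclideanSpace ℝ (Fin d)}

/-- The joint characteristic function of the residual, `Y` and `Z`. -/
lemma integral_cexp_residual (hSX : SX.PosDef) (hD : D.PosDef) (hOm : Om.PosDef)
    (hXm : Measurable X) (hεYm : Measurable εY) (hεZm : Measurable εZ)
    (hX : P.map X = multivariateGaussian μX SX) (hεY : P.map εY = multivariateGaussian α D)
    (hεZ : P.map εZ = multivariateGaussian β Om) (hindep : iIndepFun ![X, εY, εZ] P)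
    (y z r : EuclideanSpace ℝ (Fin d)) :
    ∫ ω, Complex.exp ((⟪X ω + εY ω, y⟫ + ⟪X ω + εZ ω, z⟫ +
        ⟪X ω - posteriorMean μX α β SX D Om (X ω + εY ω) (X ω + εZ ω), r⟫ : ℝ) * Complex.I) ∂P =
      Complex.exp ((⟪y + z, μX⟫ + ⟪y, α⟫ + ⟪z, β⟫ : ℝ) * Complex.I -
        (((y + z).ofLp ⬝ᵥ (SX *ᵥ (y + z).ofLp) + y.ofLp ⬝ᵥ (D *ᵥ y.ofLp) +
          z.ofLp ⬝ᵥ (Om *ᵥ z.ofLp) : ℝ) : ℂ) / 2) *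
      Complex.exp (-((r.ofLp ⬝ᵥ (posteriorCov SX D Om *ᵥ r.ofLp) : ℝ) : ℂ) / 2) := by
  set q := posteriorCov SX D Om *ᵥ r.ofLp with hq
  set a : EuclideanSpace ℝ (Fin d) := WithLp.toLp 2 (SX⁻¹ *ᵥ q + (y + z).ofLp) with ha
  set b : EuclideanSpace ℝ (Fin d) := WithLp.toLp 2 (D⁻¹ *ᵥ (-q) + y.ofLp) with hb
  set c : EuclideanSpace ℝ (Fin d) := WithLp.toLp 2 (Om⁻¹ *ᵥ (-q) + z.ofLp) with hc
  -- `k` collects the constants, so that `a`, `b`, `c` are the frequencies at `X`, `εY`, `εZ`.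
  set k : ℝ := -(μX.ofLp ⬝ᵥ (SX⁻¹ *ᵥ q)) + α.ofLp ⬝ᵥ (D⁻¹ *ᵥ q) + β.ofLp ⬝ᵥ (Om⁻¹ *ᵥ q) with hk
  have hin (u v : EuclideanSpace ℝ (Fin d)) : ⟪u, v⟫ = u.ofLp ⬝ᵥ v.ofLp := by
    simp [EuclideanSpace.inner_eq_star_dotProduct, dotProduct_comm]
  have hlin (ω : Ω) : ⟪X ω + εY ω, y⟫ + ⟪X ω + εZ ω, z⟫ +
      ⟪X ω - posteriorMean μX α β SX D Om (X ω + εY ω) (X ω + εZ ω), r⟫ =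
      k + (⟪X ω, a⟫ + ⟪εY ω, b⟫ + ⟪εZ ω, c⟫) := by
    rw [hin _ r, dotProduct_sub_posteriorMean hSX hD hOm, ← hq]
    simp only [hin, ha, hb, hc, hk, WithLp.ofLp_sub, WithLp.ofLp_add, sub_dotProduct,
      add_dotProduct, dotProduct_add, Matrix.mulVec_neg, dotProduct_neg]
    ring
  -- The means contribute no term in `r`, as the residual is centred.
  have hmean : k + (⟪a, μX⟫ + ⟪b, α⟫ + ⟪c, β⟫) = ⟪y + z, μX⟫ + ⟪y, α⟫ + ⟪z, β⟫ := by
    simp only [real_inner_comm _ a, real_inner_comm _ b, real_inner_comm _ c,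
      real_inner_comm _ (y + z), real_inner_comm _ y, real_inner_comm _ z]
    simp only [hin, ha, hb, hc, hk, WithLp.ofLp_add, dotProduct_add, Matrix.mulVec_neg,
      dotProduct_neg]
    ring
  have hquad := quadraticForm_posterior hSX hD hOm r.ofLp y.ofLp z.ofLp
  rw [← hq, ← WithLp.ofLp_add 2 y z] at hquad
  simp_rw [hlin, Complex.ofReal_add k, add_mul (k : ℂ), Complex.exp_add, integral_const_mul]
  rw [integral_cexp_inner_of_iIndepFun hXm hεYm hεZm hindep, hX, hεY, hεZ,
    charFun_multivariateGaussian hSX.posSemidef, charFun_multivariateGaussian hD.posSemidef,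
    charFun_multivariateGaussian hOm.posSemidef, ← hmean, ← Complex.exp_add, ← Complex.exp_add,
    ← Complex.exp_add, ← Complex.exp_add]
  congr 1
  have hquad' := congrArg (fun t : ℝ => (t : ℂ)) hquad
  simp only [Complex.ofReal_add] at hquad' ⊢
  linear_combination (-1 / 2 : ℂ) * hquad'

/-- The residual `X - posteriorMean` is independent of `(Y, Z)` and has law `N(0, V)`. -/
lemma map_observations_residual_eq_prod [IsProbabilityMeasure P]
    (hSX : SX.PosDef) (hD : D.PosDef) (hOm : Om.PosDef)
    (hXm : Measurable X) (hεYm : Measurable εY) (hεZm : Measurable εZ)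
    (hX : P.map X = multivariateGaussian μX SX) (hεY : P.map εY = multivariateGaussian α D)
    (hεZ : P.map εZ = multivariateGaussian β Om) (hindep : iIndepFun ![X, εY, εZ] P) :
    P.map (fun ω => ((X ω + εY ω, X ω + εZ ω),
        X ω - posteriorMean μX α β SX D Om (X ω + εY ω) (X ω + εZ ω))) =
      (P.map fun ω => (X ω + εY ω, X ω + εZ ω)).prod
        (multivariateGaussian 0 (posteriorCov SX D Om)) := by
  have hW : Measurable fun ω => (X ω + εY ω, X ω + εZ ω) := by fun_prop
  have hR : Measurable fun ω =>
      X ω - posteriorMean μX α β SX D Om (X ω + εY ω) (X ω + εZ ω) := by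
    have hm := (measurable_posteriorMean (SX := SX) (D := D) (Om := Om) μX α β).comp hW
    simp only [Function.comp_def] at hm
    exact hXm.sub hm
  refine map_prodMk_eq_prod_of_integral_cexp_inner (W₁ := fun ω => X ω + εY ω)
    (W₂ := fun ω => X ω + εZ ω) (by fun_prop) (by fun_prop) hR _ fun y z r => ?_
  have key := integral_cexp_residual hSX hD hOm hXm hεYm hεZm hX hεY hεZ hindep y z
  rw [key r, charFun_multivariateGaussian (posteriorCov_posDef hSX hD hOm).posSemidef]
  congr 1
  · -- The law of `(Y, Z)` is the case of a zero frequency for the residual.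
    simpa using (key 0).symm
  · simp [neg_div]

end Posterior

/-! ### The expected logarithmic score of a Gaussian -/

section Score

variable {d : ℕ}

/-- The log score written as a polynomial in the coordinates. -/
lemma logScore_gaussianDensity (μ : EuclideanSpace ℝ (Fin d)) {S : Matrix (Fin d) (Fin d) ℝ}
    (hS : S.PosDef) (x : EuclideanSpace ℝ (Fin d)) :
    logScore (gaussianDensity μ S) x =
      1 / 2 * (∑ i, ∑ j, S⁻¹ i j * ((x i - μ i) * (x j - μ j)))
        + ((d : ℝ) / 2 * Real.log (2 * Real.pi) + 1 / 2 * Real.log S.det) := by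
  have hdet := hS.det_pos
  have hpi : 0 < (2 * Real.pi) ^ d := by positivity
  have hsqrt : 0 < Real.sqrt ((2 * Real.pi) ^ d * S.det) := Real.sqrt_pos.2 (by positivity)
  have hq : (x - μ).ofLp ⬝ᵥ (S⁻¹ *ᵥ (x - μ).ofLp) =
      ∑ i, ∑ j, S⁻¹ i j * ((x i - μ i) * (x j - μ j)) := by
    simp only [dotProduct, Matrix.mulVec, Finset.mul_sum, PiLp.sub_apply]
    refine Finset.sum_congr rfl fun i _ => Finset.sum_congr rfl fun j _ => by ring
  rw [logScore, gaussianDensity, Real.log_mul (inv_ne_zero hsqrt.ne') (Real.exp_ne_zero _),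
    Real.log_exp, Real.log_inv, Real.log_sqrt (by positivity), Real.log_mul hpi.ne' hdet.ne',
    Real.log_pow, hq]
  ring

lemma memLp_two_eval_sub_const (γ : Measure (EuclideanSpace ℝ (Fin d))) [IsGaussian γ]
    (μ : EuclideanSpace ℝ (Fin d)) (i : Fin d) :
    MemLp (fun x : EuclideanSpace ℝ (Fin d) => x i - μ i) 2 γ :=
  ((EuclideanSpace.proj i : EuclideanSpace ℝ (Fin d) →L[ℝ] ℝ).comp_memLp'
    (IsGaussian.memLp_id γ 2 (by norm_num))).sub (memLp_const _)

lemma integrable_logScore_gaussianDensity (γ : Measure (EuclideanSpace ℝ (Fin d))) [IsGaussian γ]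
    (μ : EuclideanSpace ℝ (Fin d)) {S : Matrix (Fin d) (Fin d) ℝ} (hS : S.PosDef) :
    Integrable (logScore (gaussianDensity μ S)) γ := by
  simp_rw [funext (logScore_gaussianDensity μ hS)]
  refine Integrable.add (Integrable.const_mul ?_ _) (integrable_const _)
  refine integrable_finsetSum _ fun i _ => integrable_finsetSum _ fun j _ => ?_
  exact ((memLp_two_eval_sub_const γ μ i).integrable_mul
    (memLp_two_eval_sub_const γ μ j)).const_mul _

lemma integral_mul_eval_sub_const (m μ : EuclideanSpace ℝ (Fin d))
    {V : Matrix (Fin d) (Fin d) ℝ} (hV : V.PosSemidef) (i j : Fin d) :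
    ∫ x, (x i - μ i) * (x j - μ j) ∂(multivariateGaussian m V) =
      V i j + (m i - μ i) * (m j - μ j) := by
  have hint (k : Fin d) : Integrable (fun x : EuclideanSpace ℝ (Fin d) => x k)
      (multivariateGaussian m V) :=
    (EuclideanSpace.proj k : EuclideanSpace ℝ (Fin d) →L[ℝ] ℝ).integrable_comp
      IsGaussian.integrable_id
  have hmean (k : Fin d) : ∫ x, (x k - μ k) ∂(multivariateGaussian m V) = m k - μ k := by
    rw [integral_sub (hint k) (integrable_const _), integral_const]
    have h := (EuclideanSpace.proj k : EuclideanSpace ℝ (Fin d) →L[ℝ] ℝ).integral_comp_comm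
      (IsGaussian.integrable_id (μ := multivariateGaussian m V))
    rw [integral_id_multivariateGaussian'] at h
    simp only [EuclideanSpace.coe_proj, id] at h
    simp [h]
  have hcov := covariance_eq_sub (memLp_two_eval_sub_const (multivariateGaussian m V) μ i)
    (memLp_two_eval_sub_const (multivariateGaussian m V) μ j)
  rw [covariance_sub_const_left (hint i), covariance_sub_const_right (hint j),
    covariance_eval_multivariateGaussian hV, hmean, hmean] at hcov
  simp only [Pi.mul_apply] at hcov
  linarith

lemma integral_logScore_gaussianDensity (m μ : EuclideanSpace ℝ (Fin d))
    {S V : Matrix (Fin d) (Fin d) ℝ} (hS : S.PosDef) (hV : V.PosSemidef) :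
    ∫ x, logScore (gaussianDensity μ S) x ∂(multivariateGaussian m V) =
      gaussianScoreFormula μ S V m := by
  have hint (i j : Fin d) : Integrable (fun x : EuclideanSpace ℝ (Fin d) =>
      S⁻¹ i j * ((x i - μ i) * (x j - μ j))) (multivariateGaussian m V) :=
    ((memLp_two_eval_sub_const _ μ i).integrable_mul (memLp_two_eval_sub_const _ μ j)).const_mul _
  have hVT (i j : Fin d) : V i j = V j i := by simpa using! hV.isHermitian.apply j i
  simp_rw [logScore_gaussianDensity μ hS]
  rw [integral_add
      (Integrable.const_mul (integrable_finsetSum _ fun i _ => integrable_finsetSum _ fun j _ =>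
        hint i j) _) (integrable_const _), integral_const_mul, integral_const,
    integral_finsetSum _ fun i _ => integrable_finsetSum _ fun j _ => hint i j]
  simp_rw [integral_finsetSum _ fun j _ => hint _ j, integral_const_mul,
    integral_mul_eval_sub_const m μ hV]
  have htr : (S⁻¹ * (V + Matrix.vecMulVec (m - μ).ofLp (m - μ).ofLp)).trace =
      ∑ i, ∑ j, S⁻¹ i j * (V i j + (m i - μ i) * (m j - μ j)) := by
    simp only [Matrix.trace, Matrix.diag, Matrix.mul_apply, Matrix.add_apply,
      Matrix.vecMulVec_apply, PiLp.sub_apply]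
    refine Finset.sum_congr rfl fun i _ => Finset.sum_congr rfl fun j _ => ?_
    rw [hVT j i, mul_comm (m j - μ j)]
  rw [gaussianScoreFormula, htr]
  simp [add_assoc]

end Score

theorem proposition7 {d : ℕ} {Ω : Type*} [MeasurableSpace Ω] (P : Measure Ω)
    [IsProbabilityMeasure P]
    (μX α β : EuclideanSpace ℝ (Fin d)) (SX D Om : Matrix (Fin d) (Fin d) ℝ)
    (hSX : SX.PosDef) (hD : D.PosDef) (hOm : Om.PosDef)
    (X εY εZ Y Z : Ω → EuclideanSpace ℝ (Fin d))
    (hXm : Measurable X) (hεYm : Measurable εY) (hεZm : Measurable εZ)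
    (hX : P.map X = multivariateGaussian μX SX)
    (hεY : P.map εY = multivariateGaussian α D)
    (hεZ : P.map εZ = multivariateGaussian β Om)
    (hindep : iIndepFun ![X, εY, εZ] P)
    (hY : ∀ ω, Y ω = X ω + εY ω) (hZ : ∀ ω, Z ω = X ω + εZ ω) :
    -- the posterior distribution of `X` given `(Y, Z) = (y, z)`
    (∀ᵐ p ∂(P.map (fun ω => (Y ω, Z ω))),
      condDistrib X (fun ω => (Y ω, Z ω)) P p =
        multivariateGaussian (posteriorMean μX α β SX D Om p.1 p.2) (posteriorCov SX D Om)) ∧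
    -- the corrected log score of a forecast `N(μ, S)`
    ∀ (μ : EuclideanSpace ℝ (Fin d)) (S : Matrix (Fin d) (Fin d) ℝ), S.PosDef →
      Integrable (fun ω => logScore (gaussianDensity μ S) (X ω)) P ∧
      (∀ᵐ p ∂(P.map (fun ω => (Y ω, Z ω))),
        Integrable (logScore (gaussianDensity μ S))
          (condDistrib X (fun ω => (Y ω, Z ω)) P p) ∧
        correctedScore (logScore (gaussianDensity μ S)) X (fun ω => (Y ω, Z ω)) P p =
          gaussianScoreFormula μ S (posteriorCov SX D Om)
            (posteriorMean μX α β SX D Om p.1 p.2)) ∧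
      P[fun ω => logScore (gaussianDensity μ S) (X ω) |
          MeasurableSpace.comap (fun ω => (Y ω, Z ω)) inferInstance] =ᵐ[P]
        fun ω => gaussianScoreFormula μ S (posteriorCov SX D Om)
          (posteriorMean μX α β SX D Om (Y ω) (Z ω)) := by
  obtain rfl : Y = fun ω => X ω + εY ω := funext hY
  obtain rfl : Z = fun ω => X ω + εZ ω := funext hZ
  have hW : Measurable fun ω => (X ω + εY ω, X ω + εZ ω) := by fun_prop
  have hpost : ∀ᵐ p ∂(P.map (fun ω => (X ω + εY ω, X ω + εZ ω))),
      condDistrib X (fun ω => (X ω + εY ω, X ω + εZ ω)) P p =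
        multivariateGaussian (posteriorMean μX α β SX D Om p.1 p.2) (posteriorCov SX D Om) := by
    filter_upwards [condDistrib_ae_eq_map_const_add _ hXm hW (measurable_posteriorMean μX α β)
      (map_observations_residual_eq_prod hSX hD hOm hXm hεYm hεZm hX hεY hεZ hindep)] with p hp
    rw [hp, multivariateGaussian_zero_map_const_add]
  refine ⟨hpost, fun μ S hS => ?_⟩
  have hVsd := (posteriorCov_posDef hSX hD hOm).posSemidef
  have hint : Integrable (fun ω => logScore (gaussianDensity μ S) (X ω)) P := by
    have h := integrable_logScore_gaussianDensity (multivariateGaussian μX SX) μ hS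
    rw [← hX] at h
    exact h.comp_measurable hXm
  have hscore : ∀ᵐ p ∂(P.map (fun ω => (X ω + εY ω, X ω + εZ ω))),
      Integrable (logScore (gaussianDensity μ S))
        (condDistrib X (fun ω => (X ω + εY ω, X ω + εZ ω)) P p) ∧
      correctedScore (logScore (gaussianDensity μ S)) X
          (fun ω => (X ω + εY ω, X ω + εZ ω)) P p =
        gaussianScoreFormula μ S (posteriorCov SX D Om)
          (posteriorMean μX α β SX D Om p.1 p.2) := by
    filter_upwards [hpost] with p hp
    rw [correctedScore, hp]
    exact ⟨integrable_logScore_gaussianDensity _ μ hS, integral_logScore_gaussianDensity _ μ hS hVsd⟩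
  refine ⟨hint, hscore, ?_⟩
  have hmeas : StronglyMeasurable (logScore (gaussianDensity μ S)) := by
    rw [funext (logScore_gaussianDensity μ hS)]
    exact Continuous.stronglyMeasurable (by fun_prop)
  filter_upwards [condExp_ae_eq_integral_condDistrib hW hXm.aemeasurable hmeas hint,
    ae_of_ae_map hW.aemeasurable hscore] with ω h₁ h₂
  exact h₁.trans h₂.2
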